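/- Let $\mathcal{A}=\{a_1,\dots,a_n\}$ be a finite set of colors and consider colorings $c\colon\mathbb{Z}^2\to\mathcal{A}$. The king grid is the graph with vertex set $\mathbb{Z}^2$ in which $\vec u,\vec v$ are adjacent if and only if $\vec u-\vec v\in\{(\pm1,0),(0,\pm1),(\pm1,\pm1)\}$. For $r\ge 1$ let $D=\{\vec u\in\mathbb{Z}^2 : d(\vec u,\vec 0)\le r\}$ be its relative $r$-neighborhood, where $d$ is the graph distance. Let $\mathbf{B}=(b_{ij})$ be an $n\times n$ integer matrix. The coloring $c$ is a $D$-perfect coloring with matrix $\mathbf{B}$ if for all $i,j$ and every $\vec u\in\mathbb{Z}^2$ with $c(\vec u)=a_j$, exactly $b_{ij}$ cells of $\vec u+D$ have color $a_i$. It is an $r$-perfect coloring of the king grid with matrix $\mathbf{B}$ if for all $i,j$ the $r$-neighborhood $\{\vec v : d(\vec v,\vec u)\le r\}$ of every vertex $\vec u$ of color $a_j$ contains exactly $b_{ij}$ vertices of color $a_i$. It is two-periodic if there are two linearly independent vectors $\vec t\in\mathbb{Z}^2$ such that $c(\vec u-\vec t)=c(\vec u)$ for all $\vec u\in\mathbb{Z}^2$.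 **Corollary.** Let $r\ge 1$ and let $D$ be the relative $r$-neighborhood of the king grid. Then every $D$-perfect coloring with matrix $\mathbf{B}$ is two-periodic whenever $\det(\mathbf{B})\neq 0$. In other words, every $r$-perfect coloring with matrix $\mathbf{B}$ in the king grid is two-periodic whenever $\det(\mathbf{B})\ne 0$. -/

import Mathlib

namespace GridColoring

/-- The cells of the `d`-dimensional integer grid. -/
abbrev Cell (d : ℕ) : Type := Fin d → ℤ

/-- A `d`-dimensional configuration over the alphabet `A`. -/
abbrev Configuration (d : ℕ) (A : Type*) : Type _ := Cell d → A

/-- The translation of a configuration by `t`. -/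
def translate {d : ℕ} {A : Type*} (t : Cell d) (c : Configuration d A) : Configuration d A :=
  fun u => c (u - t)

/-- `c` is `t`-periodic. -/
def IsPeriodicBy {d : ℕ} {A : Type*} (t : Cell d) (c : Configuration d A) : Prop :=
  translate t c = c

/-- `c` has `d` linearly independent vectors of periodicity. -/
def StronglyPeriodic {d : ℕ} {A : Type*} (c : Configuration d A) : Prop :=
  ∃ t : Fin d → Cell d, LinearIndependent ℤ t ∧ ∀ k, IsPeriodicBy (t k) c

/-- A two-dimensional configuration is two-periodic if it is strongly periodic. -/
def TwoPeriodic {A : Type*} (c : Configuration 2 A) : Prop :=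
  StronglyPeriodic c

/-- `c` is a perfect coloring with respect to `D` with matrix `B`: around any cell `u` of color `j`
the number of cells of color `i` in `u + D` is `B i j`. (The finiteness clause is automatic for
a finite `D`.) -/
def IsPerfectColoring {d : ℕ} {A : Type*} (D : Set (Cell d)) (B : Matrix A A ℤ)
    (c : Configuration d A) : Prop :=
  ∀ i j : A, ∀ u : Cell d, c u = j →
    {v : Cell d | v - u ∈ D ∧ c v = i}.Finite ∧
      ({v : Cell d | v - u ∈ D ∧ c v = i}.ncard : ℤ) = B i j

/-- The vertices at graph distance at most `r` from `u`. -/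
def neighborhood {V : Type*} (G : SimpleGraph V) (r : ℕ) (u : V) : Set V :=
  {v : V | G.edist v u ≤ (r : ℕ∞)}

/-- The vertex coloring `φ` of `G` is an `r`-perfect coloring with matrix `B`: the number of
vertices of color `i` in the `r`-neighborhood of a vertex of color `j` is `B i j`. -/
def IsRadiusPerfectColoring {V : Type*} {A : Type*} (G : SimpleGraph V) (r : ℕ)
    (B : Matrix A A ℤ) (φ : V → A) : Prop :=
  ∀ i j : A, ∀ u : V, φ u = j →
    {v : V | v ∈ neighborhood G r u ∧ φ v = i}.Finite ∧
      ({v : V | v ∈ neighborhood G r u ∧ φ v = i}.ncard : ℤ) = B i j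

/-- The relative `r`-neighborhood of a graph on the grid: the `r`-neighborhood of the origin. -/
def relativeNeighborhood {d : ℕ} (G : SimpleGraph (Cell d)) (r : ℕ) : Set (Cell d) :=
  neighborhood G r 0

/-- The eight moves of a king. -/
def kingMoves : Set (Cell 2) :=
  {![1, 0], ![-1, 0], ![0, 1], ![0, -1], ![1, 1], ![1, -1], ![-1, 1], ![-1, -1]}

/-- The king grid. -/
def kingGrid : SimpleGraph (Cell 2) where
  Adj u v := u - v ∈ kingMoves
  symm := ⟨by
    intro u v h
    rw [← neg_sub]
    simp only [kingMoves, Set.mem_insert_iff, Set.mem_singleton_iff] at h ⊢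
    rcases h with h | h | h | h | h | h | h | h <;> simp [h]⟩
  loopless := ⟨by
    intro u h
    simp only [kingMoves, Set.mem_insert_iff, Set.mem_singleton_iff, sub_self] at h
    rcases h with h | h | h | h | h | h | h | h <;>
      first
        | simpa using congrFun h 0
        | simpa using congrFun h 1⟩

end GridColoring

namespace GridColoring

/-! Let polynomials in two variables act on integer arrays through the unit shifts. Balls of the
king grid are squares, so the color indicators form a vector killed by the matrix h(x)h(y)I - (xy)^r
B, where h(t) = 1 + t + ⋯ + t^(2r). Multiplying by the adjugate, its determinant P annihilates every
indicator (`det_mem_annihilatorIdeal`).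

Let z = (x, y) be a common zero, with nonzero coordinates, of the complex annihilators of an
indicator. Two constraints hold. From P(z) = 0, the number λ = h(x)h(y)/(xy)^r is an eigenvalue of
B, nonzero because det B ≠ 0. Moreover, P stays an annihilator when its exponents are dilated by a
factor without small primes; applying this to the factors 1 + N!j yields x^a y^b = 1 for one of
finitely many exponents (a, b) ≠ 0 (`exists_monomial_eq_one`). For λ ≠ 0 these two constraints leave
only finitely many x (`finite_fst_of_monomial_eq_one`); for λ = 0 the curve could contain a whole
line y = const.

By the Nullstellensatz, some power of y·x·∏(x - s) is then an annihilator. Shifts being invertible,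
this is one monic recurrence valid in all rows, and finitely many values force a period common to
all rows. Exchanging the axes gives the vertical period. -/

open MvPolynomial

/-! ### Polynomials acting on arrays by shifts -/

/-- The value at `(u, v)` of the result of letting a bivariate polynomial act on a bi-infinite
array, where the variables act as the two unit shifts. -/
noncomputable def evalAt {R : Type*} [CommRing R] (x : ℤ → ℤ → R) (u v : ℤ) :
    MvPolynomial (Fin 2) R →ₗ[R] R :=
  (basisMonomials (Fin 2) R).constr R fun m => x (u + m 0) (v + m 1)

theorem evalAt_monomial {R : Type*} [CommRing R] (x : ℤ → ℤ → R) (u v : ℤ) (m : Fin 2 →₀ ℕ)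
    (a : R) : evalAt x u v (monomial m a) = a * x (u + m 0) (v + m 1) := by
  have h : evalAt x u v (monomial m 1) = x (u + m 0) (v + m 1) := by
    have := (basisMonomials (Fin 2) R).constr_basis R (fun m => x (u + m 0) (v + m 1)) m
    rwa [coe_basisMonomials] at this
  rw [← h, ← smul_eq_mul, ← map_smul, smul_monomial, smul_eq_mul, mul_one]

theorem evalAt_monomial_mul {R : Type*} [CommRing R] (x : ℤ → ℤ → R) (u v : ℤ) (m : Fin 2 →₀ ℕ)
    (a : R) (f : MvPolynomial (Fin 2) R) :
    evalAt x u v (monomial m a * f) = a * evalAt x (u + m 0) (v + m 1) f := by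
  induction f using MvPolynomial.induction_on' with
  | monomial n b =>
    rw [monomial_mul, evalAt_monomial, evalAt_monomial]
    simp only [Finsupp.add_apply, Nat.cast_add, add_assoc, mul_assoc]
  | add f g hf hg => rw [mul_add, map_add, map_add, hf, hg, mul_add]

theorem evalAt_expand {R : Type*} [CommRing R] (x : ℤ → ℤ → R) (u v : ℤ) (k : ℕ)
    (f : MvPolynomial (Fin 2) R) :
    evalAt x u v (expand k f) =
      ∑ m ∈ f.support, f.coeff m * x (u + (k * m 0 : ℕ)) (v + (k * m 1 : ℕ)) := by
  conv_lhs => rw [f.as_sum, map_sum, map_sum]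
  simp only [expand_monomial, evalAt_monomial, Finsupp.smul_apply, smul_eq_mul]

theorem evalAt_map_intCast (x : ℤ → ℤ → ℤ) (u v : ℤ) (f : MvPolynomial (Fin 2) ℤ) :
    evalAt (fun i j => (x i j : ℂ)) u v (map (Int.castRingHom ℂ) f) = (evalAt x u v f : ℂ) := by
  induction f using MvPolynomial.induction_on' with
  | monomial n b => simp [evalAt_monomial, map_monomial]
  | add f g hf hg => simp [map_add, hf, hg]

/-- The ideal of polynomials that annihilate a bi-infinite array. -/
noncomputable def annihilatorIdeal {R : Type*} [CommRing R] (x : ℤ → ℤ → R) :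
    Ideal (MvPolynomial (Fin 2) R) where
  carrier := {f | ∀ u v, evalAt x u v f = 0}
  add_mem' hf hg u v := by rw [map_add, hf, hg, add_zero]
  zero_mem' u v := map_zero _
  smul_mem' g f hf u v := by
    rw [smul_eq_mul]
    induction g using MvPolynomial.induction_on' with
    | monomial n b => rw [evalAt_monomial_mul, hf, mul_zero]
    | add g h hg hh => rw [add_mul, map_add, hg, hh, add_zero]

theorem dvd_evalAt (x : ℤ → ℤ → ℤ) (u v : ℤ) (a : ℤ) {f : MvPolynomial (Fin 2) ℤ}
    (h : C a ∣ f) : a ∣ evalAt x u v f := by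
  obtain ⟨g, rfl⟩ := h
  rw [C_apply, evalAt_monomial_mul]
  exact dvd_mul_right _ _

/-! ### Dilated annihilators -/

/-- Frobenius modulo p, together with Fermat's little theorem for the coefficients. -/
theorem C_dvd_expand_sub_pow (p : ℕ) [Fact p.Prime] (f : MvPolynomial (Fin 2) ℤ) :
    C (p : ℤ) ∣ expand p f - f ^ p := by
  rw [C_dvd_iff_zmod, map_sub, map_expand, expand_zmod, map_pow, sub_self]

/-- The bound is independent of k, so a single threshold on the primes serves for all successive
dilations. -/
theorem abs_evalAt_expand_le {x : ℤ → ℤ → ℤ} (hx : ∀ i j, |x i j| ≤ 1) (u v : ℤ) (k : ℕ)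
    (f : MvPolynomial (Fin 2) ℤ) :
    |evalAt x u v (expand k f)| ≤ ∑ m ∈ f.support, |f.coeff m| := by
  rw [evalAt_expand]
  refine (Finset.abs_sum_le_sum_abs _ _).trans (Finset.sum_le_sum fun m _ => ?_)
  rw [abs_mul]
  exact mul_le_of_le_one_right (abs_nonneg _) (hx _ _)

/-- Dilating an annihilator of a bounded array by a factor without small prime divisors gives an
annihilator. -/
theorem expand_mem_annihilatorIdeal {x : ℤ → ℤ → ℤ} (hx : ∀ i j, |x i j| ≤ 1)
    {f : MvPolynomial (Fin 2) ℤ} (hf : f ∈ annihilatorIdeal x) (k : ℕ) (hk : k ≠ 0)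
    (hfac : ∀ p : ℕ, p.Prime → p ∣ k → ∑ m ∈ f.support, |f.coeff m| < p) :
    expand k f ∈ annihilatorIdeal x := by
  induction k using induction_on_primes with
  | zero => exact absurd rfl hk
  | one => rwa [expand_one_apply]
  | prime_mul p a hp ih =>
    have := Fact.mk hp
    have ha := ih (right_ne_zero_of_mul hk) fun q hq hqa => hfac q hq (hqa.mul_left p)
    intro u v
    have h1 := dvd_evalAt x u v p (C_dvd_expand_sub_pow p (expand a f))
    rw [← expand_mul, map_sub, Ideal.pow_mem_of_mem _ ha p hp.pos u v, sub_zero] at h1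
    -- A multiple of p of absolute value less than p is zero.
    exact Int.eq_zero_of_abs_lt_dvd h1
      ((abs_evalAt_expand_le hx u v _ f).trans_lt (hfac p hp (dvd_mul_right p a)))

/-! ### Common zeros of the annihilators -/

/-- A common zero of the annihilators of a bounded integer array satisfies a nontrivial monomial
relation coming from the support of any annihilator with nonzero constant coefficient. -/
theorem exists_monomial_eq_one {x : ℤ → ℤ → ℤ} (hx : ∀ i j, |x i j| ≤ 1)
    {f : MvPolynomial (Fin 2) ℤ} (hf : f ∈ annihilatorIdeal x) (hf0 : f.coeff 0 ≠ 0)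
    {z : Fin 2 → ℂ}
    (hz : z ∈ zeroLocus ℂ (annihilatorIdeal fun i j => (x i j : ℂ))) :
    ∃ m ∈ f.support, m ≠ 0 ∧
      (z 0 ^ m 0 * z 1 ^ m 1) ^ (∑ m ∈ f.support, |f.coeff m|).toNat.factorial = 1 := by
  set N := (∑ m ∈ f.support, |f.coeff m|).toNat with hN
  set w : (Fin 2 →₀ ℕ) → ℂ := fun m => (z 0 ^ m 0 * z 1 ^ m 1) with hw
  have key : ∀ j : ℕ, ∑ m ∈ f.support, ((f.coeff m : ℤ) : ℂ) * w m *
      (w m ^ N.factorial) ^ j = 0 := by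
    intro j
    -- This factor is 1 modulo every prime up to N.
    have h1 : expand (1 + N.factorial * j) f ∈ annihilatorIdeal x := by
      refine expand_mem_annihilatorIdeal hx hf _ (by omega) fun p hp hpk => ?_
      by_contra! hlt
      have hpN : p ≤ N := by omega
      have h2 : p ∣ N.factorial * j := (hp.dvd_factorial.2 hpN).mul_right j
      exact hp.one_lt.ne' (Nat.dvd_one.1 ((Nat.dvd_add_left h2).1 hpk))
    have h2 : map (Int.castRingHom ℂ) (expand (1 + N.factorial * j) f) ∈
        annihilatorIdeal fun i j => (x i j : ℂ) := by
      intro u v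
      rw [evalAt_map_intCast, h1 u v, Int.cast_zero]
    have h3 := hz _ h2
    rw [aeval_eq_eval, eval_map, eval₂_expand, eval₂_eq'] at h3
    rw [← h3]
    refine Finset.sum_congr rfl fun m _ => ?_
    simp only [Fin.prod_univ_two, Pi.pow_apply, hw]
    simp
    ring
  -- The relations for the powers j extend linearly to all polynomials, as in a Vandermonde
  -- argument.
  have hpoly : ∀ q : Polynomial ℂ,
      ∑ m ∈ f.support, ((f.coeff m : ℤ) : ℂ) * w m * q.eval (w m ^ N.factorial) = 0 := by
    intro q
    induction q using Polynomial.induction_on' with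
    | add p q hp hq =>
      simp only [Polynomial.eval_add, mul_add, Finset.sum_add_distrib, hp, hq, add_zero]
    | monomial n a =>
      have := congrArg (a * ·) (key n)
      simp only [Finset.mul_sum, mul_zero] at this
      rw [← this]
      refine Finset.sum_congr rfl fun m _ => ?_
      rw [Polynomial.eval_monomial]
      ring
  by_contra! hne
  have h0 : (0 : Fin 2 →₀ ℕ) ∈ f.support := mem_support_iff.2 hf0
  -- This polynomial kills every term except m = 0, leaving f₀ ∏ (1 - w_m^(N!)) = 0.
  have h := hpoly (∏ m ∈ f.support.erase 0, (Polynomial.X - Polynomial.C (w m ^ N.factorial)))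
  rw [Finset.sum_eq_single_of_mem 0 h0] at h
  · have hw0 : w 0 = 1 := by simp [hw]
    rw [hw0, Polynomial.eval_prod, mul_one, one_pow, mul_eq_zero, Finset.prod_eq_zero_iff] at h
    rcases h with h | ⟨m, hm, h⟩
    · exact hf0 (by exact_mod_cast h)
    · rw [Polynomial.eval_sub, Polynomial.eval_X, Polynomial.eval_C, sub_eq_zero] at h
      exact hne m (Finset.mem_of_mem_erase hm) (Finset.ne_of_mem_erase hm) h.symm
  · intro m hm hm0
    rw [Polynomial.eval_prod, Finset.prod_eq_zero (Finset.mem_erase.2 ⟨hm0, hm⟩), mul_zero]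
    simp

theorem finite_setOf_pow_eq_one {n : ℕ} (hn : n ≠ 0) : {x : ℂ | x ^ n = 1}.Finite := by
  refine (Polynomial.finite_setOfPred_isRoot
    (Polynomial.X_pow_sub_C_ne_zero (Nat.pos_of_ne_zero hn) (1 : ℂ))).subset fun x hx => ?_
  simpa [sub_eq_zero] using hx

theorem sum_range_zero_pow_mul {b n : ℕ} (hb : b ≠ 0) :
    ∑ i ∈ Finset.range (n + 1), (0 : ℂ) ^ (b * i) = 1 := by
  rw [Finset.sum_eq_single_of_mem 0 (by simp)]
  · simp
  · intro i _ hi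
    exact zero_pow (mul_ne_zero hb hi)

/-- The curve `h(x) h(y) = λ (x y) ^ r` with `h = 1 + t + ⋯ + t ^ (2 r)` and `λ ≠ 0` contains only
finitely many points of a given one-dimensional subgroup of the torus. -/
theorem finite_fst_of_monomial_eq_one {r : ℕ} (hr : r ≠ 0) {a b : ℕ} (hab : ¬(a = 0 ∧ b = 0))
    {l : ℂ} (hl : l ≠ 0) :
    {x : ℂ | x ≠ 0 ∧ ∃ y : ℂ, y ≠ 0 ∧ x ^ a * y ^ b = 1 ∧
      (∑ i ∈ Finset.range (2 * r + 1), x ^ i) * (∑ i ∈ Finset.range (2 * r + 1), y ^ i) =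
        l * (x * y) ^ r}.Finite := by
  by_cases hb : b = 0
  · refine (finite_setOf_pow_eq_one (n := a) fun ha => hab ⟨ha, hb⟩).subset ?_
    rintro x ⟨-, y, -, h, -⟩
    simpa [hb] using h
  by_cases ha : a = 0
  · set p : ℂ → Polynomial ℂ := fun y =>
      (∑ i ∈ Finset.range (2 * r + 1), Polynomial.X ^ i) *
        Polynomial.C (∑ i ∈ Finset.range (2 * r + 1), y ^ i) -
          Polynomial.C (l * y ^ r) * Polynomial.X ^ r with hp
    have heval : ∀ x y, (p y).eval x = (∑ i ∈ Finset.range (2 * r + 1), x ^ i) *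
        (∑ i ∈ Finset.range (2 * r + 1), y ^ i) - l * y ^ r * x ^ r := by
      intro x y
      simp [hp, Polynomial.eval_finsetSum]
    refine ((finite_setOf_pow_eq_one hb).biUnion (t := fun y => {x | y ≠ 0 ∧ (p y).IsRoot x})
      fun y _ => ?_).subset ?_
    · by_cases hy : y = 0
      · simp [hy]
      refine (Polynomial.finite_setOfPred_isRoot (p := p y) fun h0 => ?_).subset fun x hx => hx.2
      -- If the polynomial were zero, its value at 0 would give h(y) = 0, and then its value at 1
      -- would give l y^r = 0.
      have h1 := heval 0 y
      have h2 := heval 1 y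
      have h3 := sum_range_zero_pow_mul (b := 1) (n := 2 * r) one_ne_zero
      simp only [one_mul] at h3
      rw [h0, Polynomial.eval_zero, h3, zero_pow hr, mul_zero, sub_zero, one_mul] at h1
      rw [h0, Polynomial.eval_zero, ← h1, mul_zero, zero_sub, one_pow, mul_one] at h2
      exact mul_ne_zero hl (pow_ne_zero r hy) (neg_eq_zero.1 h2.symm)
    · rintro x ⟨-, y, hy, h, he⟩
      refine Set.mem_biUnion (x := y) (by simpa [ha] using h) ⟨hy, ?_⟩
      rw [Polynomial.IsRoot, heval, he]
      ring
  -- Parametrize x = s^b, y = c s^(-a) with c^b = 1, and clear denominators by s^(2ra). The constant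
  -- term is c^(2r) ≠ 0.
  · set p : ℂ → Polynomial ℂ := fun c =>
      (∑ i ∈ Finset.range (2 * r + 1), Polynomial.X ^ (b * i)) *
        (∑ i ∈ Finset.range (2 * r + 1), Polynomial.C (c ^ (2 * r - i)) * Polynomial.X ^ (a * i)) -
          Polynomial.C (l * c ^ r) * Polynomial.X ^ (b * r + a * r) with hp
    have heval : ∀ s c, (p c).eval s = (∑ i ∈ Finset.range (2 * r + 1), s ^ (b * i)) *
        (∑ i ∈ Finset.range (2 * r + 1), c ^ (2 * r - i) * s ^ (a * i)) -
          l * c ^ r * s ^ (b * r + a * r) := by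
      intro x y
      simp [hp, Polynomial.eval_finsetSum]
    refine ((finite_setOf_pow_eq_one hb).biUnion
      (t := fun c => (fun s => s ^ b) '' {s | c ≠ 0 ∧ (p c).IsRoot s}) fun c _ => ?_).subset ?_
    · refine Set.Finite.image _ ?_
      by_cases hc : c = 0
      · simp [hc]
      refine (Polynomial.finite_setOfPred_isRoot (p := p c) fun h0 => ?_).subset fun x hx => hx.2
      have h1 := heval 0 c
      rw [h0, Polynomial.eval_zero, sum_range_zero_pow_mul hb, zero_pow (by positivity), mul_zero,
        sub_zero, one_mul, Finset.sum_eq_single_of_mem 0 (by simp)] at h1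
      · simp only [Nat.sub_zero, mul_zero, pow_zero, mul_one] at h1
        exact pow_ne_zero _ hc h1.symm
      · intro i _ hi
        rw [zero_pow (mul_ne_zero ha hi), mul_zero]
    · rintro x ⟨hx, y, hy, h, he⟩
      obtain ⟨s, rfl⟩ := IsAlgClosed.exists_pow_nat_eq x (Nat.pos_of_ne_zero hb)
      have hs : s ≠ 0 := by
        rintro rfl
        exact hx (zero_pow hb)
      refine Set.mem_biUnion (x := y * s ^ a) ?_ ⟨s, ⟨mul_ne_zero hy (pow_ne_zero a hs), ?_⟩, rfl⟩
      · rw [Set.mem_ofPred_eq, ← h]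
        ring
      · have h2 : ∑ i ∈ Finset.range (2 * r + 1), (y * s ^ a) ^ (2 * r - i) * s ^ (a * i) =
            s ^ (2 * r * a) * ∑ i ∈ Finset.range (2 * r + 1), y ^ i := by
          rw [← Finset.sum_range_reflect (fun i => y ^ i), Finset.mul_sum]
          refine Finset.sum_congr rfl fun i hi => ?_
          obtain ⟨k, hk⟩ := Nat.exists_eq_add_of_le (Nat.lt_succ_iff.1 (Finset.mem_range.1 hi))
          have h3 : 2 * r + 1 - 1 - i = k := by omega
          have h4 : 2 * r - i = k := by omega
          rw [h3, h4, hk]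
          ring
        rw [Polynomial.IsRoot, heval, h2]
        simp only [← pow_mul] at he
        linear_combination s ^ (2 * r * a) * he

/-! ### From finitely many zeros to recurrence and period -/

/-- If the common zeros in the torus of the annihilators of an array have only finitely many first
coordinates, then all rows of the array satisfy a common monic linear recurrence. -/
theorem exists_monic_recurrence {x : ℤ → ℤ → ℂ} {S : Set ℂ} (hS : S.Finite)
    (hx : ∀ z ∈ zeroLocus ℂ (annihilatorIdeal x), z 0 ≠ 0 → z 1 ≠ 0 → z 0 ∈ S) :
    ∃ q : Polynomial ℂ, q.Monic ∧ ∀ u v : ℤ,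
      ∑ i ∈ Finset.range (q.natDegree + 1), q.coeff i * x (u + i) v = 0 := by
  -- The factor X here, and `X 1` below, cover the zeros outside the torus.
  set p : Polynomial ℂ := Polynomial.X * ∏ s ∈ hS.toFinset, (Polynomial.X - Polynomial.C s) with hp
  have hpm : p.Monic := Polynomial.monic_X.mul (Polynomial.monic_prod_X_sub_C _ _)
  have hmem : X 1 * Polynomial.aeval (X 0) p ∈
      vanishingIdeal ℂ (zeroLocus ℂ (annihilatorIdeal x)) := by
    rw [mem_vanishingIdeal_iff]
    intro z hz
    rw [map_mul, ← Polynomial.aeval_algHom_apply, aeval_X, aeval_X, mul_eq_zero]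
    by_cases h1 : z 1 = 0
    · exact Or.inl h1
    refine Or.inr ?_
    rw [hp, map_mul, Polynomial.aeval_X, mul_eq_zero]
    by_cases h0 : z 0 = 0
    · exact Or.inl h0
    refine Or.inr ?_
    rw [map_prod]
    exact Finset.prod_eq_zero (hS.mem_toFinset.2 (hx z hz h0 h1)) (by simp)
  rw [vanishingIdeal_zeroLocus_eq_radical] at hmem
  obtain ⟨n, hn⟩ := hmem
  refine ⟨p ^ n, hpm.pow n, fun u v => ?_⟩
  -- Starting n rows lower cancels the shift by `X 1 ^ n`.
  have h := hn u (v - n)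
  rw [mul_pow, ← map_pow, X_pow_eq_monomial, evalAt_monomial_mul, Polynomial.aeval_eq_sum_range,
    map_sum] at h
  rw [← h, one_mul]
  refine Finset.sum_congr rfl fun i _ => ?_
  rw [map_smul, X_pow_eq_monomial, evalAt_monomial]
  simp

/-- A sequence with values in a finite set that satisfies a monic linear recurrence is periodic,
with a period that depends only on the order of the recurrence and the number of values. -/
theorem periodic_of_monic_recurrence {x : ℤ → ℂ} {V : Finset ℂ} (hV : ∀ n, x n ∈ V)
    {q : Polynomial ℂ} (hq : q.Monic)
    (h : ∀ u : ℤ, ∑ i ∈ Finset.range (q.natDegree + 1), q.coeff i * x (u + i) = 0) (u : ℤ) :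
    x (u + (V.card ^ q.natDegree).factorial) = x u := by
  set d := q.natDegree with hd
  set N := V.card ^ d with hN
  -- Windows start at u - N, ..., u, so two equal ones force a period at most N that is already in
  -- effect at u; it divides N!.
  set W : Fin (N + 1) → (Fin d → V) := fun k i => ⟨x (u - N + k + i), hV _⟩ with hW
  obtain ⟨i, j, hij, hWij⟩ : ∃ i j, i < j ∧ W i = W j := by
    obtain ⟨i, j, hne, he⟩ := Fintype.exists_ne_map_eq_of_card_lt W (by simp [hN])
    rcases lt_or_gt_of_ne hne with hlt | hlt
    · exact ⟨i, j, hlt, he⟩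
    · exact ⟨j, i, hlt, he.symm⟩
  have hlt : (i : ℕ) < j := hij
  have hjN := j.2
  obtain ⟨p, hp⟩ := Nat.exists_eq_add_of_lt hlt
  have hstep : ∀ t : ℕ, x (u - N + i + t) = x (u - N + j + t) := by
    intro t
    induction t using Nat.strong_induction_on with
    | _ t ih =>
      by_cases htd : t < d
      · exact congrArg Subtype.val (congrFun hWij ⟨t, htd⟩)
      · obtain ⟨s, rfl⟩ := Nat.exists_eq_add_of_le (not_lt.1 htd)
        have h1 := h (u - N + i + s)
        have h2 := h (u - N + j + s)
        rw [Finset.sum_range_succ, hq.coeff_natDegree, one_mul] at h1 h2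
        have h3 : ∑ k ∈ Finset.range d, q.coeff k * x (u - N + i + s + k) =
            ∑ k ∈ Finset.range d, q.coeff k * x (u - N + j + s + k) := by
          refine Finset.sum_congr rfl fun k hk => ?_
          have := ih (s + k) (by have := Finset.mem_range.1 hk; omega)
          push_cast at this
          rw [add_assoc _ (s : ℤ), this, ← add_assoc]
        have h4 : x (u - N + i + s + d) = x (u - N + j + s + d) := by
          linear_combination h1 - h2 - h3
        push_cast
        rw [add_comm (d : ℤ), ← add_assoc, h4, ← add_assoc]
  have hper : ∀ m : ℕ, x (u + m) = x (u + m + (p + 1 : ℕ)) := by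
    intro m
    have h1 := hstep (N - i + m)
    have e1 : u - N + i + (N - i + m : ℕ) = u + m := by omega
    have e2 : u - N + j + (N - i + m : ℕ) = u + m + (p + 1 : ℕ) := by omega
    rwa [e1, e2] at h1
  have hmul : ∀ k : ℕ, x (u + ((p + 1) * k : ℕ)) = x u := by
    intro k
    induction k with
    | zero => simp
    | succ k ih =>
      rw [← ih, Nat.mul_succ, Nat.cast_add, ← add_assoc, ← hper]
  obtain ⟨k, hk⟩ : p + 1 ∣ N.factorial := Nat.dvd_factorial p.succ_pos (by omega)
  rw [hk, hmul]

/-! ### The determinant of the coloring -/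

/-- The array marking the cells of color `a`. -/
def colorIndicator {A : Type*} [DecidableEq A] (c : ℤ → ℤ → A) (a : A) : ℤ → ℤ → ℤ :=
  fun u v => if c u v = a then 1 else 0

/-- The generating polynomial of a square block with side `2 r + 1`. -/
noncomputable def blockPolynomial (r : ℕ) : MvPolynomial (Fin 2) ℤ :=
  (∑ i ∈ Finset.range (2 * r + 1), X 0 ^ i) * ∑ j ∈ Finset.range (2 * r + 1), X 1 ^ j

/-- The matrix of polynomials that kills the vector of color indicators of a coloring for which
the square blocks centered at cells of color `b` have `B a b` cells of color `a`. -/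
noncomputable def blockMatrix {A : Type*} [DecidableEq A] (r : ℕ) (B : Matrix A A ℤ) :
    Matrix A A (MvPolynomial (Fin 2) ℤ) :=
  blockPolynomial r • 1 - (X 0 ^ r * X 1 ^ r : MvPolynomial (Fin 2) ℤ) • B.map C

theorem evalAt_X_pow_mul_X_pow {R : Type*} [CommRing R] (x : ℤ → ℤ → R) (u v : ℤ) (i j : ℕ) :
    evalAt x u v (X 0 ^ i * X 1 ^ j) = x (u + i) (v + j) := by
  rw [X_pow_eq_monomial, X_pow_eq_monomial, monomial_mul, evalAt_monomial]
  simp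

theorem evalAt_blockPolynomial (x : ℤ → ℤ → ℤ) (u v : ℤ) (r : ℕ) :
    evalAt x u v (blockPolynomial r) =
      ∑ i ∈ Finset.range (2 * r + 1), ∑ j ∈ Finset.range (2 * r + 1), x (u + i) (v + j) := by
  simp only [blockPolynomial, Finset.sum_mul_sum, map_sum, evalAt_X_pow_mul_X_pow]

theorem evalAt_blockMatrix {A : Type*} [DecidableEq A] (r : ℕ) (B : Matrix A A ℤ)
    (x : ℤ → ℤ → ℤ) (u v : ℤ) (a b : A) :
    evalAt x u v (blockMatrix r B a b) =
      (if a = b then ∑ i ∈ Finset.range (2 * r + 1), ∑ j ∈ Finset.range (2 * r + 1),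
        x (u + i) (v + j) else 0) - B a b * x (u + r) (v + r) := by
  have h : blockMatrix r B a b =
      (if a = b then blockPolynomial r else 0) - monomial 0 (B a b) * (X 0 ^ r * X 1 ^ r) := by
    simp [blockMatrix, Matrix.one_apply, mul_comm]
  rw [h, map_sub, evalAt_monomial_mul, evalAt_X_pow_mul_X_pow, apply_ite (evalAt x u v), map_zero,
    evalAt_blockPolynomial]
  simp

theorem sum_evalAt_mul_eq_zero {ι R : Type*} [Fintype ι] [CommRing R] {x : ι → ℤ → ℤ → R}
    {g : ι → MvPolynomial (Fin 2) R} (h : ∀ u v, ∑ b, evalAt (x b) u v (g b) = 0)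
    (f : MvPolynomial (Fin 2) R) (u v : ℤ) : ∑ b, evalAt (x b) u v (f * g b) = 0 := by
  induction f using MvPolynomial.induction_on' with
  | monomial n a => simp only [evalAt_monomial_mul, ← Finset.mul_sum, h, mul_zero]
  | add f f' hf hf' => simp only [add_mul, map_add, Finset.sum_add_distrib, hf, hf', add_zero]

/-- If a square matrix of polynomials kills a vector of arrays, then its determinant annihilates
all entries of the vector. -/
theorem det_mem_annihilatorIdeal {ι R : Type*} [Fintype ι] [DecidableEq ι] [CommRing R]
    {x : ι → ℤ → ℤ → R} {M : Matrix ι ι (MvPolynomial (Fin 2) R)}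
    (h : ∀ a u v, ∑ b, evalAt (x b) u v (M a b) = 0) (e : ι) :
    M.det ∈ annihilatorIdeal (x e) := by
  intro u v
  have h1 : ∀ b, ∑ a, M.adjugate e a * M a b = if e = b then M.det else 0 := by
    intro b
    rw [← Matrix.mul_apply, Matrix.adjugate_mul, Matrix.smul_apply, Matrix.one_apply, smul_eq_mul,
      mul_ite, mul_one, mul_zero]
  have h2 : ∑ b, evalAt (x b) u v (∑ a, M.adjugate e a * M a b) = 0 := by
    simp only [map_sum]
    rw [Finset.sum_comm]
    exact Finset.sum_eq_zero fun a _ => sum_evalAt_mul_eq_zero (h a) _ u v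
  rw [Finset.sum_eq_single e] at h2
  · rwa [h1, if_pos rfl] at h2
  · intro b _ hb
    rw [h1, if_neg hb.symm, map_zero]
  · simp

/-- Setting both variables to 0 turns the block matrix into the identity, since r > 0 removes the B
term. -/
theorem coeff_zero_det_blockMatrix {A : Type*} [Fintype A] [DecidableEq A] {r : ℕ} (hr : r ≠ 0)
    (B : Matrix A A ℤ) : (blockMatrix r B).det.coeff 0 = 1 := by
  rw [← constantCoeff_eq, RingHom.map_det]
  convert Matrix.det_one (n := A) (R := ℤ)
  ext a b
  have h : ∀ k : Fin 2, ∑ i ∈ Finset.range (2 * r + 1),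
      (constantCoeff (X k ^ i : MvPolynomial (Fin 2) ℤ)) = 1 := by
    intro k
    rw [Finset.sum_eq_single_of_mem 0 (by simp)]
    · simp
    · intro i _ hi
      simp [hi]
  have h0 : ∀ k : Fin 2, constantCoeff (X k ^ r : MvPolynomial (Fin 2) ℤ) = 0 := by simp [hr]
  simp [blockMatrix, blockPolynomial, Matrix.one_apply, apply_ite constantCoeff,
    map_sum, -map_pow, h, h0]

theorem eval_det_blockMatrix {A : Type*} [Fintype A] [DecidableEq A] {r : ℕ} (B : Matrix A A ℤ)
    {z : Fin 2 → ℂ} (h0 : z 0 ≠ 0) (h1 : z 1 ≠ 0)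
    (hz : eval₂ (Int.castRingHom ℂ) z (blockMatrix r B).det = 0) :
    (B.map (Int.castRingHom ℂ)).charpoly.IsRoot
      ((∑ i ∈ Finset.range (2 * r + 1), z 0 ^ i) * (∑ i ∈ Finset.range (2 * r + 1), z 1 ^ i) /
        (z 0 * z 1) ^ r) := by
  set l := (∑ i ∈ Finset.range (2 * r + 1), z 0 ^ i) *
    (∑ i ∈ Finset.range (2 * r + 1), z 1 ^ i) / (z 0 * z 1) ^ r with hl
  have hne : (z 0 * z 1) ^ r ≠ 0 := pow_ne_zero _ (mul_ne_zero h0 h1)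
  rw [← coe_eval₂Hom, RingHom.map_det] at hz
  have hM : (eval₂Hom (Int.castRingHom ℂ) z).mapMatrix (blockMatrix r B) =
      (z 0 * z 1) ^ r • (Matrix.scalar A l - B.map (Int.castRingHom ℂ)) := by
    ext a b
    have h2 : (z 0 * z 1) ^ r * l = (∑ i ∈ Finset.range (2 * r + 1), z 0 ^ i) *
        (∑ i ∈ Finset.range (2 * r + 1), z 1 ^ i) := by
      rw [hl, mul_div_cancel₀ _ hne]
    have h3 : ∀ n : ℤ, eval₂ (Int.castRingHom ℂ) z (n : MvPolynomial (Fin 2) ℤ) = n :=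
      fun n => map_intCast (eval₂Hom (Int.castRingHom ℂ) z) n
    by_cases hab : a = b
    · subst hab
      simp [blockMatrix, blockPolynomial, mul_sub, h3, eval₂_sum, eval₂_mul, eval₂_pow]
      rw [← h2, mul_pow]
    · simp [blockMatrix, blockPolynomial, mul_pow, hab, h3, eval₂_mul, eval₂_pow]
  rw [hM, Matrix.det_smul, mul_eq_zero] at hz
  rw [Polynomial.IsRoot, Matrix.eval_charpoly]
  exact hz.resolve_left (pow_ne_zero _ hne)

theorem not_isRoot_charpoly_zero {A : Type*} [Fintype A] [DecidableEq A] {B : Matrix A A ℤ}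
    (hB : B.det ≠ 0) : ¬ (B.map (Int.castRingHom ℂ)).charpoly.IsRoot 0 := by
  rw [Polynomial.IsRoot, Matrix.eval_charpoly, map_zero, zero_sub, Matrix.det_neg, mul_eq_zero,
    not_or, ← RingHom.mapMatrix_apply, ← RingHom.map_det]
  exact ⟨pow_ne_zero _ (by norm_num), by simpa using hB⟩

/-! ### Periods along the axes -/

/-- A coloring of the plane whose square block counts are given by a nonsingular matrix is
periodic in the direction of the first coordinate. -/
theorem exists_period_fst {A : Type*} [Fintype A] [DecidableEq A] {r : ℕ} (hr : r ≠ 0)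
    {B : Matrix A A ℤ} (hB : B.det ≠ 0) {c : ℤ → ℤ → A}
    (hc : ∀ a u v, ∑ i ∈ Finset.range (2 * r + 1), ∑ j ∈ Finset.range (2 * r + 1),
      colorIndicator c a (u + i) (v + j) = B a (c (u + r) (v + r))) :
    ∃ L : ℕ, L ≠ 0 ∧ ∀ u v, c (u + L) v = c u v := by
  have hbound : ∀ a i j, |colorIndicator c a i j| ≤ 1 := by
    intro a i j
    unfold colorIndicator
    split_ifs <;> simp
  have hP : ∀ a, (blockMatrix r B).det ∈ annihilatorIdeal (colorIndicator c a) := by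
    refine det_mem_annihilatorIdeal fun a u v => ?_
    simp only [evalAt_blockMatrix, Finset.sum_sub_distrib, Finset.sum_ite_eq, Finset.mem_univ,
      if_true, hc]
    simp [colorIndicator]
  have hP0 := coeff_zero_det_blockMatrix hr B
  set P := (blockMatrix r B).det
  set K := (∑ m ∈ P.support, |P.coeff m|).toNat.factorial
  have hK0 : K ≠ 0 := Nat.factorial_ne_zero _
  set χ := (B.map (Int.castRingHom ℂ)).charpoly
  set S : Set ℂ := ⋃ m ∈ {m | m ∈ P.support ∧ m ≠ 0}, ⋃ l ∈ {l | χ.IsRoot l},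
    {x : ℂ | x ≠ 0 ∧ ∃ y : ℂ, y ≠ 0 ∧ x ^ (m 0 * K) * y ^ (m 1 * K) = 1 ∧
      (∑ i ∈ Finset.range (2 * r + 1), x ^ i) * (∑ i ∈ Finset.range (2 * r + 1), y ^ i) =
        l * (x * y) ^ r}
  have hS : S.Finite := by
    refine (P.support.finite_toSet.subset fun m hm => hm.1).biUnion fun m hm =>
      (Polynomial.finite_setOfPred_isRoot (Matrix.charpoly_monic _).ne_zero).biUnion fun l hl =>
        finite_fst_of_monomial_eq_one hr ?_ ?_
    · rintro ⟨h0, h1⟩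
      refine hm.2 (Finsupp.ext fun k => ?_)
      fin_cases k
      · exact (mul_eq_zero.1 h0).resolve_right hK0
      · exact (mul_eq_zero.1 h1).resolve_right hK0
    · rintro rfl
      exact not_isRoot_charpoly_zero hB hl
  have hzero : ∀ a, ∀ z ∈ zeroLocus ℂ (annihilatorIdeal fun i j => (colorIndicator c a i j : ℂ)),
      z 0 ≠ 0 → z 1 ≠ 0 → z 0 ∈ S := by
    intro a z hz h0 h1
    obtain ⟨m, hm, hm0, h⟩ := exists_monomial_eq_one (hbound a) (hP a) (by simp [hP0]) hz
    have hz2 : eval₂ (Int.castRingHom ℂ) z P = 0 := by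
      have := hz (map (Int.castRingHom ℂ) P) fun u v => by
        rw [evalAt_map_intCast, hP a u v, Int.cast_zero]
      rwa [aeval_eq_eval, eval_map] at this
    refine Set.mem_biUnion (x := m) ⟨hm, hm0⟩
      (Set.mem_biUnion (eval_det_blockMatrix B h0 h1 hz2) ⟨h0, z 1, h1, ?_, ?_⟩)
    · rw [← h, mul_pow, ← pow_mul, ← pow_mul]
    · exact (div_mul_cancel₀ _ (pow_ne_zero _ (mul_ne_zero h0 h1))).symm
  have hper : ∀ a, ∃ L : ℕ, L ≠ 0 ∧
      ∀ u v, colorIndicator c a (u + L) v = colorIndicator c a u v := by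
    intro a
    obtain ⟨q, hq, hrec⟩ := exists_monic_recurrence hS (hzero a)
    refine ⟨((({0, 1} : Finset ℂ).card ^ q.natDegree).factorial), Nat.factorial_ne_zero _,
      fun u v => ?_⟩
    have := periodic_of_monic_recurrence (x := fun n => (colorIndicator c a n v : ℂ))
      (V := {0, 1}) (fun n => by unfold colorIndicator; split_ifs <;> simp) hq
      (fun u => hrec u v) u
    exact_mod_cast this
  choose L hL0 hL using hper
  have hmul : ∀ a (k : ℕ) u v,
      colorIndicator c a (u + (L a * k : ℕ)) v = colorIndicator c a u v := by
    intro a k u v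
    induction k with
    | zero => simp
    | succ k ih => rw [← ih, Nat.mul_succ, Nat.cast_add, ← add_assoc, hL]
  -- The product is a common period of all the color indicators.
  refine ⟨∏ a, L a, Finset.prod_ne_zero_iff.2 fun a _ => hL0 a, fun u v => ?_⟩
  obtain ⟨k, hk⟩ := Finset.dvd_prod_of_mem L (Finset.mem_univ (c u v))
  have := hmul (c u v) k u v
  rw [← hk] at this
  by_contra hne
  simp only [colorIndicator, if_neg hne, if_true, zero_ne_one] at this

theorem exists_period_snd {A : Type*} [Fintype A] [DecidableEq A] {r : ℕ} (hr : r ≠ 0)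
    {B : Matrix A A ℤ} (hB : B.det ≠ 0) {c : ℤ → ℤ → A}
    (hc : ∀ a u v, ∑ i ∈ Finset.range (2 * r + 1), ∑ j ∈ Finset.range (2 * r + 1),
      colorIndicator c a (u + i) (v + j) = B a (c (u + r) (v + r))) :
    ∃ L : ℕ, L ≠ 0 ∧ ∀ u v, c u (v + L) = c u v := by
  obtain ⟨L, hL0, hL⟩ := exists_period_fst hr hB (c := fun u v => c v u) fun a u v => by
    rw [Finset.sum_comm]
    exact hc a v u
  exact ⟨L, hL0, fun u v => hL v u⟩

/-! ### Balls of the king grid -/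

theorem abs_sub_le_one_of_kingGrid_adj {u v : Cell 2} (h : kingGrid.Adj u v) (k : Fin 2) :
    |u k - v k| ≤ 1 := by
  change u - v ∈ kingMoves at h
  rw [← Pi.sub_apply]
  simp only [kingMoves, Set.mem_insert_iff, Set.mem_singleton_iff] at h
  rcases h with h | h | h | h | h | h | h | h <;> rw [h] <;> fin_cases k <;> simp

theorem kingGrid_adj_of_ne {u v : Cell 2} (hne : u ≠ v) (h : ∀ k, |u k - v k| ≤ 1) :
    kingGrid.Adj u v := by
  have h0 := abs_le.1 (h 0)
  have h1 := abs_le.1 (h 1)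
  have huv : u - v = ![u 0 - v 0, u 1 - v 1] := by
    ext k
    fin_cases k <;> rfl
  have hne' : ¬(u 0 - v 0 = 0 ∧ u 1 - v 1 = 0) := by
    rintro ⟨e0, e1⟩
    refine hne (funext fun k => ?_)
    fin_cases k
    · exact sub_eq_zero.1 e0
    · exact sub_eq_zero.1 e1
  change u - v ∈ kingMoves
  rw [huv]
  generalize u 0 - v 0 = s at *
  generalize u 1 - v 1 = t at *
  obtain ⟨hs, hs'⟩ := h0
  obtain ⟨ht, ht'⟩ := h1
  interval_cases s <;> interval_cases t <;> simp [kingMoves] at *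

theorem abs_sub_le_length {u v : Cell 2} (p : kingGrid.Walk u v) (k : Fin 2) :
    |u k - v k| ≤ p.length := by
  induction p with
  | nil => simp
  | cons h p ih =>
    rw [SimpleGraph.Walk.length_cons]
    have := abs_sub_le_one_of_kingGrid_adj h k
    rw [abs_le] at *
    push_cast
    constructor <;> linarith [this.1, this.2, ih.1, ih.2]

theorem edist_kingGrid_le {r : ℕ} {u v : Cell 2} (h : ∀ k, |u k - v k| ≤ r) :
    kingGrid.edist u v ≤ r := by
  induction r generalizing u with
  | zero =>
    have : u = v := funext fun k => by simpa [sub_eq_zero] using h k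
    simp [this]
  | succ r ih =>
    -- One king move toward v in each coordinate that still differs.
    set w : Cell 2 := fun k => u k - (u k - v k).sign with hw
    have hk : ∀ k, |u k - w k| ≤ 1 ∧ |w k - v k| ≤ r := by
      intro k
      have := h k
      simp only [hw]
      push_cast at this
      rcases lt_trichotomy (u k - v k) 0 with h0 | h0 | h0
      · rw [Int.sign_eq_neg_one_of_neg h0]
        simp only [abs_le] at *
        omega
      · rw [h0]
        simp [h0]
      · rw [Int.sign_eq_one_of_pos h0]
        simp only [abs_le] at *
        omega
    have h1 : kingGrid.edist u w ≤ 1 := by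
      rw [SimpleGraph.edist_le_one_iff_adj_or_eq]
      by_cases huw : u = w
      · exact Or.inr huw
      · exact Or.inl (kingGrid_adj_of_ne huw fun k => (hk k).1)
    calc kingGrid.edist u v ≤ kingGrid.edist u w + kingGrid.edist w v :=
          SimpleGraph.edist_triangle
      _ ≤ 1 + r := add_le_add h1 (ih fun k => (hk k).2)
      _ = (r + 1 : ℕ) := by push_cast; rw [add_comm]

/-- The balls of the king grid are squares. -/
theorem mem_neighborhood_kingGrid {r : ℕ} {u v : Cell 2} :
    v ∈ neighborhood kingGrid r u ↔ ∀ k, |v k - u k| ≤ r := by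
  refine ⟨fun h k => ?_, edist_kingGrid_le⟩
  change kingGrid.edist v u ≤ r at h
  obtain ⟨p, hp⟩ := SimpleGraph.exists_walk_of_edist_ne_top
    (ne_top_of_le_ne_top (ENat.natCast_ne_top r) h)
  rw [← hp] at h
  exact (abs_sub_le_length p k).trans (by exact_mod_cast h)

theorem sub_mem_relativeNeighborhood_kingGrid {r : ℕ} {u v : Cell 2} :
    v - u ∈ relativeNeighborhood kingGrid r ↔ v ∈ neighborhood kingGrid r u := by
  rw [relativeNeighborhood, mem_neighborhood_kingGrid, mem_neighborhood_kingGrid]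
  simp

theorem sum_colorIndicator_eq_ncard {A : Type*} [DecidableEq A] (φ : Cell 2 → A) (a : A) (r : ℕ)
    (u v : ℤ) :
    ∑ i ∈ Finset.range (2 * r + 1), ∑ j ∈ Finset.range (2 * r + 1),
        colorIndicator (fun s t => φ ![s, t]) a (u + i) (v + j) =
      ({w : Cell 2 | w ∈ neighborhood kingGrid r ![u + r, v + r] ∧ φ w = a}.ncard : ℤ) := by
  simp only [colorIndicator]
  rw [← Finset.sum_product', Finset.sum_boole, ← Set.ncard_coe_finset, Nat.cast_inj]
  refine Set.ncard_congr (fun p _ => ![u + p.1, v + p.2]) ?_ ?_ ?_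
  · rintro ⟨i, j⟩ h
    simp only [Finset.coe_filter, Finset.mem_product, Finset.mem_range, Set.mem_ofPred_eq] at h
    refine ⟨mem_neighborhood_kingGrid.2 fun k => ?_, h.2⟩
    rw [abs_le]
    fin_cases k <;> simp <;> omega
  · rintro ⟨i, j⟩ ⟨i', j'⟩ _ _ h
    have h0 := congrFun h 0
    have h1 := congrFun h 1
    simp at h0 h1
    rw [h0, h1]
  · rintro w ⟨hw, hwa⟩
    rw [mem_neighborhood_kingGrid] at hw
    have h0 := abs_le.1 (hw 0)
    have h1 := abs_le.1 (hw 1)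
    simp at h0 h1
    have he : ![u + ((w 0 - u).toNat : ℤ), v + ((w 1 - v).toNat : ℤ)] = w := by
      ext k
      fin_cases k <;> simp <;> omega
    refine ⟨((w 0 - u).toNat, (w 1 - v).toNat), ?_, he⟩
    simp only [Finset.coe_filter, Finset.mem_product, Finset.mem_range, Set.mem_ofPred_eq]
    rw [he]
    exact ⟨⟨by omega, by omega⟩, hwa⟩

/-! ### Two-periodicity -/

theorem twoPeriodic_of_axis_periods {A : Type*} {c : Cell 2 → A} {L M : ℕ} (hL0 : L ≠ 0)
    (hM0 : M ≠ 0) (hL : ∀ u v : ℤ, c ![u + L, v] = c ![u, v])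
    (hM : ∀ u v : ℤ, c ![u, v + M] = c ![u, v]) : TwoPeriodic c := by
  refine ⟨![![(L : ℤ), 0], ![0, (M : ℤ)]], ?_, ?_⟩
  · rw [LinearIndependent.pair_iff]
    intro s t h
    have h0 := congrFun h 0
    have h1 := congrFun h 1
    simp [hL0, hM0] at h0 h1
    exact ⟨h0, h1⟩
  · intro k
    funext u
    have hu : u = ![u 0, u 1] := by
      ext k
      fin_cases k <;> rfl
    have hL' := hL (u 0 - L) (u 1)
    have hM' := hM (u 0) (u 1 - M)
    rw [sub_add_cancel, ← hu] at hL' hM'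
    fin_cases k
    · simp only [translate]
      rw [hL']
      congr 1
      ext k
      fin_cases k <;> simp
    · simp only [translate]
      rw [hM']
      congr 1
      ext k
      fin_cases k <;> simp

theorem twoPeriodic_of_isRadiusPerfectColoring {A : Type*} [Fintype A] [DecidableEq A] {r : ℕ}
    (hr : r ≠ 0) {B : Matrix A A ℤ} (hB : B.det ≠ 0) {φ : Cell 2 → A}
    (h : IsRadiusPerfectColoring kingGrid r B φ) : TwoPeriodic φ := by
  have hc : ∀ a u v, ∑ i ∈ Finset.range (2 * r + 1), ∑ j ∈ Finset.range (2 * r + 1),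
      colorIndicator (fun s t => φ ![s, t]) a (u + i) (v + j) = B a (φ ![u + r, v + r]) :=
    fun a u v => by rw [sum_colorIndicator_eq_ncard, (h a _ _ rfl).2]
  obtain ⟨L, hL0, hL⟩ := exists_period_fst hr hB hc
  obtain ⟨M, hM0, hM⟩ := exists_period_snd hr hB hc
  exact twoPeriodic_of_axis_periods hL0 hM0 hL hM

end GridColoring

theorem mainTheorem2 {A : Type*} [Fintype A] [DecidableEq A] (r : ℕ) (hr : 1 ≤ r)
    (B : Matrix A A ℤ) (hB : B.det ≠ 0) :
    (∀ c : GridColoring.Configuration 2 A,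
      GridColoring.IsPerfectColoring
        (GridColoring.relativeNeighborhood GridColoring.kingGrid r) B c →
      GridColoring.TwoPeriodic c) ∧
    (∀ φ : GridColoring.Cell 2 → A,
      GridColoring.IsRadiusPerfectColoring GridColoring.kingGrid r B φ →
      GridColoring.TwoPeriodic φ) := by
  have hr0 : r ≠ 0 := Nat.one_le_iff_ne_zero.1 hr
  refine ⟨fun c hc => ?_, fun φ => GridColoring.twoPeriodic_of_isRadiusPerfectColoring hr0 hB⟩
  refine GridColoring.twoPeriodic_of_isRadiusPerfectColoring hr0 hB fun i j u hu => ?_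
  have := hc i j u hu
  simpa only [GridColoring.sub_mem_relativeNeighborhood_kingGrid] using this
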